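/- Let $\kappa>1$, $m>0$, $q_0\ge p\ge 1$ and $C>0$ be real numbers with $\kappa m q_0\ge 1$ and $$D:=(\kappa-1)q_0+p-1-\tfrac1m>0 .$$ Then there are constants $\beta^*\ge 0$ and $K>0$, depending only on $\kappa,m,p,q_0,C$, with the following property. Let $(\Sigma,\mu)$ be a $\sigma$-finite measure space, $\omega\ge 0$, and let $A\subseteq L^1(\Sigma,\mu)\times L^1(\Sigma,\mu)$ be a (possibly multivalued) operator, identified with its graph, such that $A+\omega I$ is $m$-accretive in $L^1(\Sigma,\mu)$. Let $A_{1\cap\infty}=A\cap\big((L^1\cap L^\infty)\times(L^1\cap L^\infty)\big)$ be its trace, and suppose that it satisfies the range condition $$L^1\cap L^\infty(\Sigma,\mu)\subseteq \mathrm{Rg}\big(I+(A_{1\cap\infty}+\omega I)\big).$$ Suppose that there is $(u_0,0)\in A_{1\cap\infty}$ such that for every $q\ge q_0$ the following two conditions hold: (i) for every $(u,v)\in A_{1\cap\infty}$, $$\|u-u_0\|_{\kappa m q}^{mq}\le \frac{C\,(q/p)^p}{q-p+1}\Big([u-u_0,v]_{(q-p+1)m+1}+\omega\,\|u-u_0\|_{(q-p+1)m+1}^{(q-p+1)m+1}\Big),$$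 where $[u,v]_s=\lim_{\lambda\to0+}\frac{1}{\lambda}\big(\tfrac1s\|u+\lambda v\|_s^s-\tfrac1s\|u\|_s^s\big)$; (ii) for every $\lambda>0$ with $\lambda\omega<1$, the resolvent $J_\lambda=(I+\lambda A)^{-1}$ of $A$ satisfies $$\|J_\lambda f-u_0\|_{\kappa m q}\le(1-\lambda\omega)^{-1}\|f-u_0\|_{\kappa m q}\qquad\text{for every } f\in \mathrm{Rg}(I+\lambda A_{1\cap\infty}).$$ Let $\{T_t\}_{t\ge0}$ be the semigroup generated by $-A$ on the closure $\overline{D(A)}$ of the domain of $A$ in $L^1(\Sigma,\mu)$, that is, $t\mapsto T_tu$ is the mild solution of $\frac{du}{dt}+Au\ni0$ with initial value $u$. Then for every $t>0$ and every $u\in\overline{D(A)}\cap L^\infty(\Sigma,\mu)$ one has $T_tu-u_0\in L^\infty(\Sigma,\mu)$ and $$\|T_tu-u_0\|_\infty\le K\,e^{\omega\beta^* t}\,t^{-\frac{1}{mD}}\,\|u-u_0\|_{\kappa m q_0}^{\frac{(\kappa-1)q_0}{D}} .$$ -/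

import Mathlib

open MeasureTheory Filter Topology Set
open scoped ENNReal

namespace NonlinearSemigroup

section Banach

/-- A (possibly multivalued) operator on `X`, identified with its graph: `(u, v) ∈ A` means
`v ∈ A u`. -/
abbrev Operator (X : Type*) := Set (X × X)

variable {X : Type*} [NormedAddCommGroup X] [NormedSpace ℝ X]

/-- The effective domain `D(A)`. -/
def Operator.dom (A : Operator X) : Set X := {u | ∃ v, (u, v) ∈ A}

/-- The operator `A + ω I`. -/
def Operator.addSmul (A : Operator X) (ω : ℝ) : Operator X :=
  {z | ∃ v, (z.1, v) ∈ A ∧ z.2 = v + ω • z.1}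

/-- The range `Rg(I + lam A)`. -/
def Operator.rangeId (A : Operator X) (lam : ℝ) : Set X :=
  {f | ∃ u v, (u, v) ∈ A ∧ u + lam • v = f}

/-- The graph of the resolvent `J_lam = (I + lam A)⁻¹`: `(f, u)` belongs to it if and only if
`u + lam v = f` for some `v ∈ A u`. -/
def Operator.resolvent (A : Operator X) (lam : ℝ) : Set (X × X) :=
  {z | ∃ v, (z.2, v) ∈ A ∧ z.2 + lam • v = z.1}

/-- Accretivity of `A` in `X`. -/
def Operator.IsAccretive (A : Operator X) : Prop :=
  ∀ u v u' v' : X, (u, v) ∈ A → (u', v') ∈ A → ∀ lam : ℝ, 0 ≤ lam →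
    ‖u - u'‖ ≤ ‖(u - u') + lam • (v - v')‖

/-- `m`-accretivity of `A` in `X`: accretivity and `Rg(I + lam A) = X` for some `lam > 0`. -/
def Operator.IsMAccretive (A : Operator X) : Prop :=
  A.IsAccretive ∧ ∃ lam : ℝ, 0 < lam ∧ A.rangeId lam = univ

/-- `x` is a solution, with initial value `u₀` and within `ε` of `u`, of the implicit time
discretization of `du/dt + A u ∋ 0` on `[0, S]` along the partition
`0 = τ 0 < ⋯ < τ N = S` of mesh smaller than `ε`. The approximating step function takes the value
`x (i + 1)` on `(τ i, τ (i + 1)]` and the value `u₀` at `0`. -/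
structure Operator.IsDiscretization (A : Operator X) (u₀ : X) (u : ℝ → X) (S ε : ℝ)
    (N : ℕ) (τ : ℕ → ℝ) (x : ℕ → X) : Prop where
  left : τ 0 = 0
  right : τ N = S
  step_pos : ∀ i < N, τ i < τ (i + 1)
  mesh : ∀ i < N, τ (i + 1) - τ i < ε
  init : x 0 = u₀
  scheme : ∀ i < N, ∃ v, (x (i + 1), v) ∈ A ∧ x (i + 1) + (τ (i + 1) - τ i) • v = x i
  close_zero : ‖u 0 - u₀‖ ≤ ε
  close : ∀ i < N, ∀ t ∈ Ioc (τ i) (τ (i + 1)), ‖u t - x (i + 1)‖ ≤ ε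

/-- `u` is a mild solution on `[0, ∞)` of `du/dt + A u ∋ 0`, `u(0) = u₀`: it is continuous on
`[0, ∞)`, `u(0) = u₀`, and on each `[0, S]` it is a uniform limit of solutions of implicit time
discretizations whose mesh tends to zero. -/
structure Operator.IsMildSolution (A : Operator X) (u₀ : X) (u : ℝ → X) : Prop where
  continuousOn : ContinuousOn u (Ici 0)
  init : u 0 = u₀
  approx : ∀ S > 0, ∀ ε > 0, ∃ N τ x, A.IsDiscretization u₀ u S ε N τ x

/-- `T` is the semigroup generated by `-A` on the closure of `D(A)`: for every `u` in this closure
the function `t ↦ T t u` is the mild solution with initial value `u`. (Values of `T t u` for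
`t < 0` or for `u` outside of the closure of `D(A)` are irrelevant. If `A + ω I` is `m`-accretive,
then mild solutions exist and are unique, so `T` is determined.) -/
def Operator.Generates (A : Operator X) (T : ℝ → X → X) : Prop :=
  ∀ u ∈ closure A.dom, A.IsMildSolution u fun t => T t u

end Banach

section Lebesgue

variable {Ω : Type*} [MeasurableSpace Ω]

/-- The `q`-bracket `[u, v]_q`: the right-hand directional derivative at `u` in the
direction `v` of `u ↦ (1/q) ‖u‖_q ^ q`. -/
noncomputable def qBracket (μ : Measure Ω) (q : ℝ) (u v : Ω → ℝ) : ℝ :=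
  limUnder (𝓝[>] (0 : ℝ)) fun lam : ℝ =>
    (1 / q * lpNorm (u + lam • v) (ENNReal.ofReal q) μ ^ q
      - 1 / q * lpNorm u (ENNReal.ofReal q) μ ^ q) / lam

variable {μ : Measure Ω}

/-- The trace `A ∩ ((L¹ ∩ L^∞) × (L¹ ∩ L^∞))` of an operator `A` on `L¹`. -/
def Operator.trace (A : Operator (Lp ℝ 1 μ)) : Operator (Lp ℝ 1 μ) :=
  {z | z ∈ A ∧ MemLp z.1 ∞ μ ∧ MemLp z.2 ∞ μ}

/-- The range condition `L¹ ∩ L^∞ ⊆ Rg(I + (A_{1∩∞} + ω I))`. -/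
def Operator.TraceRangeCondition (A : Operator (Lp ℝ 1 μ)) (ω : ℝ) : Prop :=
  ∀ f : Lp ℝ 1 μ, MemLp f ∞ μ → f ∈ (A.trace.addSmul ω).rangeId 1

/-- The Sobolev type inequality with parameter `q`, on the trace of `A`. -/
def Operator.SobolevIneq (A : Operator (Lp ℝ 1 μ)) (ω κ m p C : ℝ) (u₀ : Lp ℝ 1 μ)
    (q : ℝ) : Prop :=
  ∀ u v : Lp ℝ 1 μ, (u, v) ∈ A.trace →
    lpNorm (u - u₀ : Lp ℝ 1 μ) (ENNReal.ofReal (κ * m * q)) μ ^ (m * q) ≤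
      C * (q / p) ^ p / (q - p + 1) *
        (qBracket μ ((q - p + 1) * m + 1) (u - u₀ : Lp ℝ 1 μ) v
          + ω * lpNorm (u - u₀ : Lp ℝ 1 μ) (ENNReal.ofReal ((q - p + 1) * m + 1)) μ
              ^ ((q - p + 1) * m + 1))

/-- The growth bound `‖J_lam f - u₀‖_r ≤ (1 - lam ω)⁻¹ ‖f - u₀‖_r` on the resolvent of `A`, for
every `lam > 0` with `lam ω < 1` and every `f ∈ Rg(I + lam A_{1∩∞})`. -/
def Operator.ResolventGrowth (A : Operator (Lp ℝ 1 μ)) (ω : ℝ) (u₀ : Lp ℝ 1 μ) (r : ℝ) : Prop :=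
  ∀ lam : ℝ, 0 < lam → lam * ω < 1 → ∀ f ∈ A.trace.rangeId lam, ∀ w : Lp ℝ 1 μ,
    (f, w) ∈ A.resolvent lam →
      lpNorm (w - u₀ : Lp ℝ 1 μ) (ENNReal.ofReal r) μ ≤
        (1 - lam * ω)⁻¹ * lpNorm (f - u₀ : Lp ℝ 1 μ) (ENNReal.ofReal r) μ

end Lebesgue

end NonlinearSemigroup

/-! The proof is a Moser iteration on implicit Euler steps `w + h • v = f`. By convexity, `h [w -
u₀, v]_s` is at most `(‖f - u₀‖_s^s - ‖w - u₀‖_s^s) / s`, so the Sobolev inequality controls `h ‖w -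
u₀‖_{κmq}^{mq}` by the decrease of the `s`-th power, up to terms in `ω` (`energy_step`). Summed over
a block of steps and combined with the growth bound, this gives an estimate from `L^s` to `L^{κmq}`
that costs one inverse power of the block length (`discrete_smoothing`).

With `q_{k+1} = κ q_k + p - 1 - 1/m`, the inequality for `q = q_{k+1}` has `s = κ m q_k`, so these
estimates chain. On blocks of length about `t 2^{-(k+1)}` the logarithms of the constants grow
linearly in `k`, while the recursion multiplies earlier ones by `κ` (`moser_iteration`). Let `D = (κ
- 1) q₀ + p - 1 - 1/m`. Since `κ^k / q_k → (κ - 1) / D`, the roots of order `m q_k` converge and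
produce the exponents of the theorem (`tendsto_moserBound`).

The energy inequality is available only on the trace. The growth bound, passed to `r = ∞`, makes
`L^∞` balls about `u₀` invariant under a contraction; this carries the range condition to small
parameters, and uniqueness of resolvents then places the discrete solutions in the trace
(`mem_trace_of_resolvent`). For fixed `k` the estimate passes to the mild solution by lower
semicontinuity of the norm under `L¹` convergence; only then does `k → ∞`. -/

namespace NonlinearSemigroup

/-! ### Lebesgue norms: limits, interpolation and convexity. -/

section LebesgueNorms

variable {Ω : Type*} [MeasurableSpace Ω] {μ : Measure Ω}

/-- An `L^r` bound passes to limits in `L¹`. -/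
theorem eLpNorm_le_of_tendsto_L1 {f : ℕ → Lp ℝ 1 μ} {g : Lp ℝ 1 μ} {r B : ℝ≥0∞}
    (hfg : Tendsto f atTop (𝓝 g)) (hB : ∀ᶠ n in atTop, eLpNorm (f n) r μ ≤ B) :
    eLpNorm g r μ ≤ B := by
  obtain ⟨φ, hφ, hlim⟩ := (tendstoInMeasure_of_tendsto_Lp hfg).exists_seq_tendsto_ae
  exact Lp.eLpNorm_le_of_ae_tendsto (u := atTop) (hφ.tendsto_atTop.eventually hB)
    (fun n => Lp.aestronglyMeasurable _) hlim

theorem eLpNorm_le_of_interpolation {f : Ω → ℝ} (hf : AEStronglyMeasurable f μ) {r : ℝ}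
    (hr : 1 ≤ r) :
    eLpNorm f (ENNReal.ofReal r) μ ≤ eLpNorm f ∞ μ ^ (1 - 1 / r) * eLpNorm f 1 μ ^ (1 / r) := by
  have hr0 : 0 < r := by linarith
  rw [eLpNorm_eq_lintegral_rpow_enorm_toReal (by simpa using hr0) ENNReal.ofReal_ne_top,
    ENNReal.toReal_ofReal hr0.le, eLpNorm_one_eq_lintegral_enorm]
  have h1 : ∫⁻ x, ‖f x‖ₑ ^ r ∂μ ≤ eLpNorm f ∞ μ ^ (r - 1) * ∫⁻ x, ‖f x‖ₑ ∂μ := by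
    rw [← lintegral_const_mul'' _ hf.enorm]
    refine lintegral_mono_ae ?_
    filter_upwards [ae_le_eLpNormEssSup (f := f) (μ := μ)] with x hx
    rw [← eLpNorm_exponent_top] at hx
    calc ‖f x‖ₑ ^ r = ‖f x‖ₑ ^ (r - 1) * ‖f x‖ₑ := by
          conv_rhs => rw [← ENNReal.rpow_one (‖f x‖ₑ), ← ENNReal.rpow_mul]
          rw [← ENNReal.rpow_add_of_nonneg _ _ (by linarith) zero_le_one]
          ring_nf
      _ ≤ _ := by gcongr
  calc (∫⁻ x, ‖f x‖ₑ ^ r ∂μ) ^ (1 / r)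
      ≤ (eLpNorm f ∞ μ ^ (r - 1) * ∫⁻ x, ‖f x‖ₑ ∂μ) ^ (1 / r) := by gcongr
    _ = _ := by
      rw [ENNReal.mul_rpow_of_nonneg _ _ (by positivity), ← ENNReal.rpow_mul]
      congr 2
      field_simp

theorem memLp_of_memLp_one_top {f : Ω → ℝ} (h1 : MemLp f 1 μ) (h2 : MemLp f ∞ μ) {r : ℝ}
    (hr : 1 ≤ r) : MemLp f (ENNReal.ofReal r) μ := by
  have hr0 : 0 < r := by linarith
  refine ⟨h1.1, (eLpNorm_le_of_interpolation h1.1 hr).trans_lt (ENNReal.mul_lt_top ?_ ?_)⟩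
  · exact ENNReal.rpow_lt_top_of_nonneg (by rw [sub_nonneg, div_le_one hr0]; exact hr) h2.2.ne
  · exact ENNReal.rpow_lt_top_of_nonneg (by positivity) h1.2.ne

theorem lpNorm_le_of_interpolation {f : Ω → ℝ} (h1 : MemLp f 1 μ) (h2 : MemLp f ∞ μ) {r : ℝ}
    (hr : 1 ≤ r) :
    lpNorm f (ENNReal.ofReal r) μ ≤ lpNorm f ∞ μ ^ (1 - 1 / r) * lpNorm f 1 μ ^ (1 / r) := by
  have hr0 : 0 < r := by linarith
  simp only [← toReal_eLpNorm h1.1, ENNReal.toReal_rpow]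
  rw [← ENNReal.toReal_mul]
  refine ENNReal.toReal_mono (ENNReal.mul_ne_top ?_ ?_) (eLpNorm_le_of_interpolation h1.1 hr)
  · exact ENNReal.rpow_ne_top_of_nonneg (by rw [sub_nonneg, div_le_one hr0]; exact hr) h2.2.ne
  · exact ENNReal.rpow_ne_top_of_nonneg (by positivity) h1.2.ne

/-- `L^r` bounds along exponents tending to infinity give an `L^∞` bound. -/
theorem eLpNorm_top_le_of_tendsto {g : Ω → ℝ} (hg : AEStronglyMeasurable g μ) {r M : ℕ → ℝ}
    {B : ℝ} (hr : Tendsto r atTop atTop) (hM : Tendsto M atTop (𝓝 B)) (hB : 0 ≤ B)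
    (h : ∀ n, eLpNorm g (ENNReal.ofReal (r n)) μ ≤ ENNReal.ofReal (M n)) :
    eLpNorm g ∞ μ ≤ ENNReal.ofReal B := by
  rw [eLpNorm_exponent_top]
  refine le_of_forall_gt fun c hc => ?_
  obtain ⟨a, ha0, ha3, ha4⟩ := ENNReal.lt_iff_exists_real_btwn.1 hc
  have hBa : B < a := (ENNReal.ofReal_lt_ofReal_iff_of_nonneg hB).1 ha3
  refine lt_of_le_of_lt (essSup_le_of_ae_le _ ?_) ha4
  obtain ⟨b, hb1, hb2⟩ := exists_between hBa
  have hbpos : 0 < b := hB.trans_lt hb1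
  have hapos : 0 < a := hbpos.trans hb2
  -- Chebyshev bounds this measure by `(M n / a) ^ r n ≤ (b / a) ^ r n`, which tends to `0` because
  -- `b < a`.
  have hmeas : μ {x | ENNReal.ofReal a ≤ ‖g x‖ₑ} = 0 := by
    have hlim : Tendsto (fun n => ENNReal.ofReal ((b / a) ^ (r n))) atTop (𝓝 0) := by
      rw [← ENNReal.ofReal_zero]
      refine ENNReal.tendsto_ofReal ?_
      exact (tendsto_rpow_atTop_of_base_lt_one (b / a) (by
        have : 0 < b / a := by positivity
        linarith) ((div_lt_one hapos).2 hb2)).comp hr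
    refine le_antisymm (ge_of_tendsto hlim ?_) bot_le
    filter_upwards [hr.eventually_gt_atTop 0, hM.eventually (gt_mem_nhds hb1)] with n hn hMn
    have := meas_ge_le_mul_pow_eLpNorm_enorm μ (p := ENNReal.ofReal (r n)) (by simpa using hn)
      ENNReal.ofReal_ne_top hg (ε := ENNReal.ofReal a) (by simpa using hapos) (by simp)
    refine this.trans ?_
    rw [ENNReal.toReal_ofReal hn.le, ← ENNReal.mul_rpow_of_nonneg _ _ hn.le,
      ← ENNReal.ofReal_rpow_of_pos (by positivity)]
    refine ENNReal.rpow_le_rpow ?_ hn.le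
    rw [← ENNReal.ofReal_inv_of_pos hapos, div_eq_inv_mul, ENNReal.ofReal_mul (by positivity)]
    gcongr
    exact (h n).trans (ENNReal.ofReal_le_ofReal hMn.le)
  have : ∀ᵐ x ∂μ, ¬ ENNReal.ofReal a ≤ ‖g x‖ₑ := by
    rw [ae_iff]; simpa using hmeas
  filter_upwards [this] with x hx
  exact (not_le.1 hx).le

/-- If `‖g‖_r ≤ c ‖f‖_r` for all large `r`, then the same holds for `r = ∞`. -/
theorem eLpNorm_top_le_of_forall_lpNorm_le {f g : Ω → ℝ} (hf1 : MemLp f 1 μ) (hf : MemLp f ∞ μ)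
    (hg1 : MemLp g 1 μ) (hg : MemLp g ∞ μ) {c r₀ R : ℝ} (hc : 0 ≤ c)
    (hR : lpNorm f ∞ μ ≤ R) (hR0 : 0 < R)
    (h : ∀ r, r₀ ≤ r → lpNorm g (ENNReal.ofReal r) μ ≤ c * lpNorm f (ENNReal.ofReal r) μ) :
    eLpNorm g ∞ μ ≤ ENNReal.ofReal (c * R) := by
  -- The `+ 1` keeps the base positive, so that `N ^ (1 / (k + n))` tends to `1`.
  set N := lpNorm f 1 μ + 1 with hN
  have hNpos : 0 < N := by have := lpNorm_nonneg (f := f) (p := 1) (μ := μ); linarith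
  set k := max r₀ 1 with hk
  have hr : Tendsto (fun n : ℕ => k + n) atTop atTop :=
    tendsto_atTop_add_const_left _ _ tendsto_natCast_atTop_atTop
  refine eLpNorm_top_le_of_tendsto hg1.1 (r := fun n => k + n)
    (M := fun n => c * (R ^ (1 - 1 / (k + n)) * N ^ (1 / (k + n)))) hr ?_ (by positivity) ?_
  · have h0 : Tendsto (fun n : ℕ => 1 / (k + (n : ℝ))) atTop (𝓝 0) := by
      simp only [one_div]
      exact hr.inv_tendsto_atTop
    have h1 : Tendsto (fun n : ℕ => R ^ (1 - 1 / (k + (n : ℝ)))) atTop (𝓝 (R ^ (1 - 0 : ℝ))) :=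
      (Tendsto.rpow tendsto_const_nhds (tendsto_const_nhds.sub h0) (Or.inl hR0.ne'))
    have h2 : Tendsto (fun n : ℕ => N ^ (1 / (k + (n : ℝ)))) atTop (𝓝 (N ^ (0 : ℝ))) :=
      (Tendsto.rpow tendsto_const_nhds h0 (Or.inl hNpos.ne'))
    simpa using (h1.mul h2).const_mul c
  · intro n
    have hn : (1 : ℝ) ≤ k + n := by
      have := le_max_right r₀ 1
      have : (0 : ℝ) ≤ n := n.cast_nonneg
      linarith
    have hn' : r₀ ≤ k + n := by
      have := le_max_left r₀ 1
      have : (0 : ℝ) ≤ n := n.cast_nonneg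
      linarith
    rw [← ofReal_lpNorm (memLp_of_memLp_one_top hg1 hg hn)]
    refine ENNReal.ofReal_le_ofReal ((h _ hn').trans ?_)
    gcongr
    refine (lpNorm_le_of_interpolation hf1 hf hn).trans ?_
    have h1 : 0 ≤ 1 - 1 / (k + n) := by
      rw [sub_nonneg, div_le_one (by linarith)]; exact hn
    have h2 : 0 ≤ 1 / (k + n) := by positivity
    have h3 := lpNorm_nonneg (f := f) (p := ∞) (μ := μ)
    have h4 := lpNorm_nonneg (f := f) (p := 1) (μ := μ)
    have h5 : lpNorm f 1 μ ≤ N := by linarith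
    gcongr

theorem convexOn_lpNorm_rpow {u v : Ω → ℝ} {s : ℝ} (hs : 1 ≤ s)
    (hu : MemLp u (ENNReal.ofReal s) μ) (hv : MemLp v (ENNReal.ofReal s) μ) :
    ConvexOn ℝ univ fun lam : ℝ => lpNorm (u + lam • v) (ENNReal.ofReal s) μ ^ s := by
  have h1 : ConvexOn ℝ univ fun lam : ℝ => lpNorm (u + lam • v) (ENNReal.ofReal s) μ := by
    refine ⟨convex_univ, fun a _ b _ α β hα hβ hαβ => ?_⟩
    have : u + (α • a + β • b) • v = α • (u + a • v) + β • (u + b • v) := by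
      ext x
      simp only [Pi.add_apply, Pi.smul_apply, smul_eq_mul]
      linear_combination (-u x) * hαβ
    beta_reduce
    rw [this]
    refine (lpNorm_add_le ((hu.add (hv.const_smul a)).const_smul α) (by simpa using hs)).trans ?_
    rw [lpNorm_const_smul, lpNorm_const_smul]
    simp [abs_of_nonneg hα, abs_of_nonneg hβ]
  have h2 : ConvexOn ℝ ((fun lam : ℝ => lpNorm (u + lam • v) (ENNReal.ofReal s) μ) '' univ)
      fun x : ℝ => x ^ s := by
    refine (convexOn_rpow hs).subset ?_ ?_
    · rintro _ ⟨a, _, rfl⟩; exact lpNorm_nonneg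
    · refine IsPreconnected.convex ?_
      refine isPreconnected_univ.image _ ?_
      simpa using h1.continuousOn isOpen_univ
  refine h2.comp h1 ?_
  rintro _ ⟨a, _, rfl⟩ _ ⟨b, _, rfl⟩ hab
  exact Real.rpow_le_rpow lpNorm_nonneg hab (by linarith)

/-- The subgradient inequality for the bracket `[u, v]_s`. -/
theorem mul_qBracket_le {u v : Ω → ℝ} {s : ℝ} (hs : 1 ≤ s)
    (hu : MemLp u (ENNReal.ofReal s) μ) (hv : MemLp v (ENNReal.ofReal s) μ) {h : ℝ} (hh : 0 < h) :
    h * qBracket μ s u v ≤ 1 / s * (lpNorm (u + h • v) (ENNReal.ofReal s) μ ^ s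
      - lpNorm u (ENNReal.ofReal s) μ ^ s) := by
  set φ : ℝ → ℝ := fun lam => 1 / s * lpNorm (u + lam • v) (ENNReal.ofReal s) μ ^ s with hφ
  have hconv : ConvexOn ℝ univ φ := by
    simpa [hφ] using (convexOn_lpNorm_rpow hs hu hv).smul (c := 1 / s) (by positivity)
  have hder := hconv.hasDerivWithinAt_rightDeriv_of_mem_interior (x := 0) (by simp)
  -- Convexity makes the difference quotients converge, so `limUnder` is the true right derivative
  -- and not a default value.
  have hlim : qBracket μ s u v = derivWithin φ (Ioi 0) 0 := by
    have := (hasDerivWithinAt_iff_tendsto_slope' (by simp)).1 hder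
    refine Tendsto.limUnder_eq (this.congr fun lam => ?_)
    simp [slope_def_field, hφ]
  have hle := hconv.rightDeriv_le_slope_of_mem_interior (x := 0) (y := h) (by simp) (by simp) hh
  rw [← hlim, slope_def_field, sub_zero, le_div_iff₀ hh] at hle
  simp only [hφ, zero_smul, add_zero] at hle
  linarith

end LebesgueNorms

/-! ### Uniqueness of resolvents. -/

section Resolvent

variable {X : Type*} [NormedAddCommGroup X] [NormedSpace ℝ X] {A : Operator X} {ω : ℝ}

theorem norm_sub_le_of_isAccretive_addSmul (hA : (A.addSmul ω).IsAccretive) {w v w' v' : X}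
    (h1 : (w, v) ∈ A) (h2 : (w', v') ∈ A) {lam : ℝ} (hlam : 0 ≤ lam) :
    ‖w - w'‖ ≤ ‖(w + lam • (v + ω • w)) - (w' + lam • (v' + ω • w'))‖ := by
  refine (hA w (v + ω • w) w' (v' + ω • w') ⟨v, h1, rfl⟩ ⟨v', h2, rfl⟩ lam hlam).trans_eq ?_
  congr 1
  module

/-- Multiplication by `(1 - h ω)⁻¹` turns a step of `A` with parameter `h` into a step of `A + ω I`
with parameter `h / (1 - h ω)`, where accretivity applies. -/
theorem resolvent_unique (hA : (A.addSmul ω).IsAccretive) {w v w' v' : X}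
    (h1 : (w, v) ∈ A) (h2 : (w', v') ∈ A) {h : ℝ} (hh : 0 < h) (hhω : h * ω < 1)
    (heq : w + h • v = w' + h • v') : w = w' ∧ v = v' := by
  have h3 : 0 < 1 - h * ω := by linarith
  have key := norm_sub_le_of_isAccretive_addSmul hA h1 h2 (lam := h / (1 - h * ω)) (by positivity)
  have e : (w + (h / (1 - h * ω)) • (v + ω • w)) - (w' + (h / (1 - h * ω)) • (v' + ω • w'))
      = (1 - h * ω)⁻¹ • ((w + h • v) - (w' + h • v')) := by
    match_scalars <;> field_simp <;> ring
  rw [e, heq, sub_self, smul_zero, norm_zero] at key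
  have hw : w = w' := sub_eq_zero.1 (norm_le_zero_iff.1 key)
  refine ⟨hw, ?_⟩
  subst hw
  exact smul_right_injective X hh.ne' (add_left_cancel heq)

end Resolvent

/-! ### The range condition on the trace for small parameters. -/

section Trace

variable {Ω : Type*} [MeasurableSpace Ω] {μ : Measure Ω} {A : Operator (Lp ℝ 1 μ)} {ω : ℝ}
  {u₀ : Lp ℝ 1 μ}

theorem memLp_coe_add {q : ℝ≥0∞} {f g : Lp ℝ 1 μ} (hf : MemLp f q μ) (hg : MemLp g q μ) :
    MemLp (f + g : Lp ℝ 1 μ) q μ :=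
  (hf.add hg).ae_eq (Lp.coeFn_add f g).symm

theorem memLp_coe_sub {q : ℝ≥0∞} {f g : Lp ℝ 1 μ} (hf : MemLp f q μ) (hg : MemLp g q μ) :
    MemLp (f - g : Lp ℝ 1 μ) q μ :=
  (hf.sub hg).ae_eq (Lp.coeFn_sub f g).symm

theorem memLp_coe_smul {q : ℝ≥0∞} {f : Lp ℝ 1 μ} (c : ℝ) (hf : MemLp f q μ) :
    MemLp (c • f : Lp ℝ 1 μ) q μ :=
  (hf.const_smul c).ae_eq (Lp.coeFn_smul c f).symm

theorem lpNorm_congr_of_ae {f g : Ω → ℝ} (hf : AEStronglyMeasurable f μ) (h : f =ᵐ[μ] g)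
    (q : ℝ≥0∞) : lpNorm f q μ = lpNorm g q μ := by
  rw [← toReal_eLpNorm hf, ← toReal_eLpNorm (hf.congr h), eLpNorm_congr_ae h]

theorem lpNorm_coe_smul (c : ℝ) (f : Lp ℝ 1 μ) (q : ℝ≥0∞) :
    lpNorm (c • f : Lp ℝ 1 μ) q μ = |c| * lpNorm f q μ := by
  rw [lpNorm_congr_of_ae (Lp.aestronglyMeasurable _) (Lp.coeFn_smul c f), lpNorm_const_smul]
  simp

theorem lpNorm_coe_add_le {f g : Lp ℝ 1 μ} {q : ℝ≥0∞} (hf : MemLp f q μ) (hq : 1 ≤ q) :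
    lpNorm (f + g : Lp ℝ 1 μ) q μ ≤ lpNorm f q μ + lpNorm g q μ := by
  rw [lpNorm_congr_of_ae (Lp.aestronglyMeasurable _) (Lp.coeFn_add f g)]
  exact lpNorm_add_le hf hq

/-- The resolvent of the trace satisfies the growth bound in `L^∞`. -/
theorem eLpNorm_top_resolvent_le {r₀ : ℝ} (hgrow : ∀ r, r₀ ≤ r → A.ResolventGrowth ω u₀ r)
    (hu₀ : MemLp u₀ ∞ μ) {w v f : Lp ℝ 1 μ} (hwv : (w, v) ∈ A.trace) {h : ℝ} (hh : 0 < h)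
    (hhω : h * ω < 1) (heq : w + h • v = f) {R : ℝ} (hR0 : 0 < R)
    (hR : lpNorm (f - u₀ : Lp ℝ 1 μ) ∞ μ ≤ R) :
    eLpNorm (w - u₀ : Lp ℝ 1 μ) ∞ μ ≤ ENNReal.ofReal ((1 - h * ω)⁻¹ * R) := by
  have hf : MemLp f ∞ μ := heq ▸ memLp_coe_add hwv.2.1 (memLp_coe_smul h hwv.2.2)
  refine eLpNorm_top_le_of_forall_lpNorm_le (Lp.memLp _) (memLp_coe_sub hf hu₀) (Lp.memLp _)
    (memLp_coe_sub hwv.2.1 hu₀) (r₀ := r₀) (inv_nonneg.2 (by linarith)) hR hR0 fun r hr => ?_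
  exact hgrow r hr h hh hhω f ⟨w, v, hwv, heq⟩ w ⟨v, hwv.1, heq⟩

/-- The inverse rescaling, `h = lam / (1 + lam ω)`: the growth factor `(1 - h ω)⁻¹ = 1 + lam ω`
cancels the scaling of the datum exactly. -/
theorem eLpNorm_top_resolvent_addSmul_le {r₀ : ℝ}
    (hgrow : ∀ r, r₀ ≤ r → A.ResolventGrowth ω u₀ r) (hω : 0 ≤ ω)
    (hu₀ : MemLp u₀ ∞ μ) {w v f : Lp ℝ 1 μ} (hwv : (w, v) ∈ A.trace) {lam : ℝ} (hlam : 0 < lam)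
    (heq : w + lam • (v + ω • w) = f) {R : ℝ} (hR0 : 0 < R)
    (hR : lpNorm (f - (1 + lam * ω) • u₀ : Lp ℝ 1 μ) ∞ μ ≤ R) :
    eLpNorm (w - u₀ : Lp ℝ 1 μ) ∞ μ ≤ ENNReal.ofReal R := by
  have hc : 0 < 1 + lam * ω := by positivity
  have e : (1 - lam / (1 + lam * ω) * ω)⁻¹ = 1 + lam * ω := by
    field_simp; simp
  have := eLpNorm_top_resolvent_le hgrow hu₀ hwv (f := (1 + lam * ω)⁻¹ • f)
    (h := lam / (1 + lam * ω)) (by positivity) (by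
      rw [div_mul_eq_mul_div, div_lt_one hc]; linarith) (by
      rw [← heq]
      match_scalars <;> field_simp) (R := (1 + lam * ω)⁻¹ * R) (by positivity) (by
      have : (1 + lam * ω)⁻¹ • f - u₀ = (1 + lam * ω)⁻¹ • (f - (1 + lam * ω) • u₀) := by
        match_scalars <;> field_simp
      rw [this, lpNorm_coe_smul, abs_of_pos (by positivity)]
      gcongr)
  rwa [e, mul_inv_cancel_left₀ hc.ne'] at this

/-- `L¹ ∩ L^∞ ⊆ Rg(I + lam (A_{1∩∞} + ω I))`. -/
def Operator.TraceRangeAt (A : Operator (Lp ℝ 1 μ)) (ω lam : ℝ) : Prop :=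
  ∀ f : Lp ℝ 1 μ, MemLp f ∞ μ → ∃ w v, (w, v) ∈ A.trace ∧ w + lam • (v + ω • w) = f

theorem isClosed_eLpNorm_sub_le (q B : ℝ≥0∞) (u₀ : Lp ℝ 1 μ) :
    IsClosed {w : Lp ℝ 1 μ | eLpNorm (w - u₀ : Lp ℝ 1 μ) q μ ≤ B} := by
  refine isClosed_of_closure_subset fun w hw => ?_
  obtain ⟨x, hx, hlim⟩ := mem_closure_iff_seq_limit.1 hw
  exact eLpNorm_le_of_tendsto_L1 (hlim.sub_const u₀) (Eventually.of_forall hx)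

/-- With `J` the resolvent of `A + ω I` at `lam`, the equation at `lam'` is the fixed point problem
`w = J ((lam / lam') f + (1 - lam / lam') w)`. It is a contraction in `L¹` because `lam < 2 lam'`,
and it preserves an `L^∞` ball about `u₀`, which is closed in `L¹`. -/
theorem Operator.TraceRangeAt.step {r₀ : ℝ} (hgrow : ∀ r, r₀ ≤ r → A.ResolventGrowth ω u₀ r) (hω : 0 ≤ ω)
    (hA : (A.addSmul ω).IsAccretive) (hu₀ : MemLp u₀ ∞ μ) {lam lam' : ℝ} (hlam' : 0 < lam')
    (hle : lam' ≤ lam) (hlt : lam < 2 * lam') (H : A.TraceRangeAt ω lam) :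
    A.TraceRangeAt ω lam' := by
  intro f hf
  have hlam : 0 < lam := hlam'.trans_le hle
  choose! J V hJ using H
  set c : ℝ := 1 - lam / lam' with hc
  have hc0 : c ≤ 0 := by
    rw [hc, sub_nonpos, one_le_div hlam']; exact hle
  have hc1 : |c| < 1 := by
    rw [abs_of_nonpos hc0, hc, neg_sub, sub_lt_iff_lt_add, div_lt_iff₀ hlam']; linarith
  set g : Lp ℝ 1 μ := (lam / lam') • f - (lam / lam' + lam * ω) • u₀ with hg
  have hgtop : MemLp g ∞ μ := memLp_coe_sub (memLp_coe_smul _ hf) (memLp_coe_smul _ hu₀)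
  set G := lpNorm g ∞ μ + 1 with hG
  have hGpos : 0 < G := by have := lpNorm_nonneg (f := g) (p := ∞) (μ := μ); linarith
  -- The radius solves `G + |c| R = R`, which is what invariance of the ball requires.
  set R := G / (1 - |c|) with hR
  have hRpos : 0 < R := div_pos hGpos (by linarith)
  have hGR : G + |c| * R = R := by
    have : 1 - |c| ≠ 0 := by linarith
    rw [hR]; field_simp; ring
  set K : Set (Lp ℝ 1 μ) := {w | eLpNorm (w - u₀ : Lp ℝ 1 μ) ∞ μ ≤ ENNReal.ofReal R} with hK
  have hKsub : ∀ w ∈ K, MemLp (w - u₀ : Lp ℝ 1 μ) ∞ μ := fun w hw =>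
    ⟨Lp.aestronglyMeasurable _, lt_of_le_of_lt hw ENNReal.ofReal_lt_top⟩
  have hKtop : ∀ w ∈ K, MemLp ((lam / lam') • f + c • w : Lp ℝ 1 μ) ∞ μ := fun w hw => by
    have := memLp_coe_add (hKsub w hw) hu₀
    rw [sub_add_cancel] at this
    exact memLp_coe_add (memLp_coe_smul _ hf) (memLp_coe_smul _ this)
  have hKlp : ∀ w ∈ K, lpNorm (w - u₀ : Lp ℝ 1 μ) ∞ μ ≤ R := fun w hw => by
    rw [← toReal_eLpNorm (Lp.aestronglyMeasurable _)]
    exact ENNReal.toReal_le_of_le_ofReal hRpos.le hw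
  set F : Lp ℝ 1 μ → Lp ℝ 1 μ := fun w => J ((lam / lam') • f + c • w) with hF
  have hmaps : MapsTo F K K := by
    intro w hw
    obtain ⟨h1, h2⟩ := hJ _ (hKtop w hw)
    refine eLpNorm_top_resolvent_addSmul_le hgrow hω hu₀ h1 hlam h2 hRpos ?_
    have e : (lam / lam') • f + c • w - (1 + lam * ω) • u₀ = g + c • (w - u₀) := by
      rw [hg, hc]; module
    rw [e]
    refine (lpNorm_coe_add_le hgtop le_top).trans ?_
    rw [lpNorm_coe_smul]
    calc lpNorm g ∞ μ + |c| * lpNorm (w - u₀ : Lp ℝ 1 μ) ∞ μ ≤ G + |c| * R := by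
          have := mul_le_mul_of_nonneg_left (hKlp w hw) (abs_nonneg c)
          linarith
      _ = R := hGR
  have hcontr : ContractingWith ⟨|c|, abs_nonneg c⟩ (hmaps.restrict F K K) := by
    refine ⟨by exact_mod_cast hc1, LipschitzWith.of_dist_le_mul fun x y => ?_⟩
    obtain ⟨h1, h2⟩ := hJ _ (hKtop x x.2)
    obtain ⟨h3, h4⟩ := hJ _ (hKtop y y.2)
    have := norm_sub_le_of_isAccretive_addSmul hA h1.1 h3.1 hlam.le
    rw [h2, h4, add_sub_add_left_eq_sub, ← smul_sub, norm_smul, Real.norm_eq_abs] at this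
    rw [Subtype.dist_eq, Subtype.dist_eq, dist_eq_norm, dist_eq_norm]
    exact this
  have hu₀K : u₀ ∈ K := by
    have : eLpNorm (u₀ - u₀ : Lp ℝ 1 μ) ∞ μ = 0 := by
      rw [sub_self, eLpNorm_congr_ae (Lp.coeFn_zero ℝ 1 μ), eLpNorm_zero]
    simp only [hK, mem_ofPred_eq, this, zero_le]
  obtain ⟨w, hwK, hw, -⟩ := hcontr.exists_fixedPoint'
    (isClosed_eLpNorm_sub_le ∞ _ u₀).isComplete hmaps hu₀K (edist_ne_top _ _)
  obtain ⟨h1, h2⟩ := hJ _ (hKtop w hwK)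
  have hw' : J ((lam / lam') • f + c • w) = w := hw
  rw [hw'] at h1 h2
  refine ⟨w, _, h1, ?_⟩
  have h3 : (lam / lam') • (w + lam' • (V ((lam / lam') • f + c • w) + ω • w))
      = (lam / lam') • f := by
    have : (lam / lam') • (w + lam' • (V ((lam / lam') • f + c • w) + ω • w))
      = (w + lam • (V ((lam / lam') • f + c • w) + ω • w)) - c • w := by
      rw [hc]
      match_scalars <;> field_simp <;> ring
    rw [this, h2]; module
  exact smul_right_injective _ (div_pos hlam hlam').ne' h3

theorem traceRangeAt_of_le_one {r₀ : ℝ} (hgrow : ∀ r, r₀ ≤ r → A.ResolventGrowth ω u₀ r)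
    (hω : 0 ≤ ω) (hA : (A.addSmul ω).IsAccretive) (hu₀ : MemLp u₀ ∞ μ)
    (H : A.TraceRangeCondition ω) {lam : ℝ} (hlam : 0 < lam) (hle : lam ≤ 1) :
    A.TraceRangeAt ω lam := by
  -- One step lowers the parameter by any factor above `1 / 2`; powers of `2 / 3` leave room for a
  -- last step to `lam`.
  have h1 : ∀ n : ℕ, A.TraceRangeAt ω ((2 / 3) ^ n) := by
    intro n
    induction n with
    | zero =>
      intro f hf
      obtain ⟨w, b, ⟨v, hv, hb⟩, hwb⟩ := H f hf
      exact ⟨w, v, hv, by rw [pow_zero, ← hwb]; simp only at hb; rw [hb]⟩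
    | succ n ih =>
      have : (0 : ℝ) < (2 / 3) ^ n := by positivity
      exact ih.step hgrow hω hA hu₀ (by positivity) (by rw [pow_succ]; linarith)
        (by rw [pow_succ]; linarith)
  obtain ⟨n, hn1, hn2⟩ := exists_nat_pow_near_of_lt_one hlam hle (y := (2 / 3 : ℝ))
    (by norm_num) (by norm_num)
  rw [pow_succ] at hn1
  exact (h1 n).step hgrow hω hA hu₀ hlam hn2 (by linarith)

/-- Small resolvents map `L¹ ∩ L^∞` into the domain of the trace. -/
theorem mem_trace_of_resolvent {r₀ : ℝ} (hgrow : ∀ r, r₀ ≤ r → A.ResolventGrowth ω u₀ r)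
    (hω : 0 ≤ ω) (hA : (A.addSmul ω).IsAccretive) (hu₀ : MemLp u₀ ∞ μ)
    (H : A.TraceRangeCondition ω) {h : ℝ} (hh : 0 < h) (hhω : h * (1 + ω) ≤ 1 / 2)
    {f w v : Lp ℝ 1 μ} (hf : MemLp f ∞ μ) (hwv : (w, v) ∈ A) (heq : w + h • v = f) :
    (w, v) ∈ A.trace := by
  have h1 : 0 ≤ h * ω := by positivity
  have h2 : 0 < 1 - h * ω := by linarith
  -- Here `h (1 + ω) ≤ 1 / 2` gives `h ≤ 1 - h ω`, so the rescaled parameter is at most `1`.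
  -- Uniqueness identifies the resulting trace pair with `(w, v)`.
  obtain ⟨w', v', hwv', heq'⟩ := traceRangeAt_of_le_one hgrow hω hA hu₀ H
    (lam := h / (1 - h * ω)) (by positivity) (by rw [div_le_one h2]; linarith)
    ((1 - h * ω)⁻¹ • f) (memLp_coe_smul _ hf)
  have e : w' + h • v' = f := by
    refine smul_right_injective _ (inv_pos.2 h2).ne' ?_
    change (1 - h * ω)⁻¹ • (w' + h • v') = (1 - h * ω)⁻¹ • f
    rw [← heq']
    match_scalars <;> field_simp <;> ring
  obtain ⟨rfl, rfl⟩ := resolvent_unique hA hwv hwv'.1 hh (by linarith) (heq.trans e.symm)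
  exact hwv'

end Trace

/-! ### Discrete smoothing and the abstract Moser iteration. -/

section Iteration

theorem exp_neg_two_mul_le {x : ℝ} (h0 : 0 ≤ x) (h1 : x ≤ 1 / 2) :
    Real.exp (-(2 * x)) ≤ 1 - x := by
  have h2 : 2 * x + 1 ≤ Real.exp (2 * x) := Real.add_one_le_exp _
  rw [Real.exp_neg, inv_le_comm₀ (Real.exp_pos _) (by linarith)]
  refine le_trans ?_ h2
  rw [inv_le_iff_one_le_mul₀ (by linarith)]
  nlinarith

theorem partition_mono {N : ℕ} {τ : ℕ → ℝ} (hτ : ∀ i < N, τ i < τ (i + 1)) {i j : ℕ}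
    (hij : i ≤ j) (hj : j ≤ N) : τ i ≤ τ j := by
  induction j, hij using Nat.le_induction with
  | base => exact le_rfl
  | succ j hij ih => exact (ih (by omega)).trans (hτ j (by omega)).le

theorem exists_partition_point {N : ℕ} {τ : ℕ → ℝ} {ε S : ℝ} (h0 : τ 0 = 0) (hε : 0 < ε)
    (hmesh : ∀ i < N, τ (i + 1) - τ i < ε) (hS0 : 0 ≤ S) (hSN : S ≤ τ N) :
    ∃ i ≤ N, S ≤ τ i ∧ τ i < S + ε := by
  classical
  have hex : ∃ i, S ≤ τ i := ⟨N, hSN⟩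
  refine ⟨Nat.find hex, Nat.find_min' hex hSN, Nat.find_spec hex, ?_⟩
  rcases hi : Nat.find hex with _ | i
  · rw [h0]; linarith
  · have h1 : ¬ S ≤ τ i := Nat.find_min hex (by omega)
    have h2 : i + 1 ≤ N := hi ▸ Nat.find_min' hex hSN
    have := hmesh i (by omega)
    linarith

theorem discrete_growth {N : ℕ} {τ F : ℕ → ℝ} {g : ℝ}
    (hgrow : ∀ i < N, F (i + 1) ≤ Real.exp (g * (τ (i + 1) - τ i)) * F i) {i j : ℕ}
    (hij : i ≤ j) (hj : j ≤ N) : F j ≤ Real.exp (g * (τ j - τ i)) * F i := by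
  induction j, hij using Nat.le_induction with
  | base => simp
  | succ j hij ih =>
    refine (hgrow j (by omega)).trans ?_
    refine (mul_le_mul_of_nonneg_left (ih (by omega)) (Real.exp_pos _).le).trans_eq ?_
    rw [← mul_assoc, ← Real.exp_add]
    congr 2
    ring

/-- Smoothing effect of a discrete energy inequality over a block of steps. -/
theorem discrete_smoothing {N : ℕ} {τ E F : ℕ → ℝ} {ω c s e : ℝ} (hω : 0 ≤ ω) (hc : 0 ≤ c)
    (hs : 0 ≤ s) (he : 0 ≤ e) (hτ : ∀ i < N, τ i < τ (i + 1)) (hE : ∀ i, 0 ≤ E i)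
    (hF : ∀ i, 0 ≤ F i) (hstep : ∀ i < N, s * ω * (τ (i + 1) - τ i) ≤ 1 / 2)
    (hgrow : ∀ i < N, F (i + 1) ≤ Real.exp (2 * e * ω * (τ (i + 1) - τ i)) * F i)
    (hen : ∀ i < N, (τ (i + 1) - τ i) * F (i + 1)
      + c * ((1 - s * ω * (τ (i + 1) - τ i)) * E (i + 1)) ≤ c * E i)
    {i j : ℕ} (hij : i ≤ j) (hj : j ≤ N) :
    (τ j - τ i) * F j ≤ c * E i * Real.exp ((2 * s + 2 * e) * ω * (τ j - τ i)) := by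
  -- Elapsed time times `F`, plus `c E`, with exponential weights, never exceeds its initial value.
  -- Rate `2 s ω` absorbs the factor `1 - s ω h`; the extra `2 e ω` absorbs the growth of `F`.
  have key : (τ j - τ i) * F j * Real.exp (-((2 * s + 2 * e) * ω * (τ j - τ i)))
      + c * E j * Real.exp (-(2 * s * ω * (τ j - τ i))) ≤ c * E i := by
    induction j, hij using Nat.le_induction with
    | base => simp
    | succ j hij ih =>
      specialize ih (by omega)
      have hL : 0 ≤ τ j - τ i := sub_nonneg.2 (partition_mono hτ hij (by omega))
      have hh : 0 < τ (j + 1) - τ j := sub_pos.2 (hτ j (by omega))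
      have h1 := hgrow j (by omega)
      have h2 := hen j (by omega)
      have h3 := exp_neg_two_mul_le (x := s * ω * (τ (j + 1) - τ j)) (by positivity)
        (hstep j (by omega))
      obtain ⟨L, hLdef⟩ : ∃ L, L = τ j - τ i := ⟨_, rfl⟩
      obtain ⟨h, hhdef⟩ : ∃ h, h = τ (j + 1) - τ j := ⟨_, rfl⟩
      have hsum : τ (j + 1) - τ i = L + h := by rw [hLdef, hhdef]; ring
      rw [← hLdef] at ih hL
      rw [← hhdef] at hh h1 h2 h3
      rw [hsum]
      have a1 : L * F (j + 1) * Real.exp (-((2 * s + 2 * e) * ω * (L + h)))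
          ≤ L * F j * Real.exp (-((2 * s + 2 * e) * ω * L)) := by
        have e1 : Real.exp (2 * e * ω * h) * Real.exp (-((2 * s + 2 * e) * ω * (L + h)))
            ≤ Real.exp (-((2 * s + 2 * e) * ω * L)) := by
          rw [← Real.exp_add]
          refine Real.exp_le_exp.2 ?_
          have : 0 ≤ s * ω * h := by positivity
          linarith
        calc L * F (j + 1) * Real.exp (-((2 * s + 2 * e) * ω * (L + h)))
            ≤ L * (Real.exp (2 * e * ω * h) * F j)
              * Real.exp (-((2 * s + 2 * e) * ω * (L + h))) := by gcongr
          _ = L * F j * (Real.exp (2 * e * ω * h)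
              * Real.exp (-((2 * s + 2 * e) * ω * (L + h)))) := by ring
          _ ≤ _ := mul_le_mul_of_nonneg_left e1 (mul_nonneg hL (hF j))
      have a2 : h * F (j + 1) * Real.exp (-((2 * s + 2 * e) * ω * (L + h)))
          ≤ Real.exp (-(2 * s * ω * L)) * (h * F (j + 1)) := by
        rw [mul_comm]
        refine mul_le_mul_of_nonneg_right (Real.exp_le_exp.2 ?_) (mul_nonneg hh.le (hF _))
        have : 0 ≤ s * ω * h := by positivity
        have : 0 ≤ e * ω * (L + h) := by positivity
        linarith
      have a3 : c * E (j + 1) * Real.exp (-(2 * s * ω * (L + h)))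
          ≤ Real.exp (-(2 * s * ω * L)) * (c * ((1 - s * ω * h) * E (j + 1))) := by
        have : Real.exp (-(2 * s * ω * (L + h)))
            = Real.exp (-(2 * s * ω * L)) * Real.exp (-(2 * (s * ω * h))) := by
          rw [← Real.exp_add]; congr 1; ring
        rw [this]
        calc c * E (j + 1) * (Real.exp (-(2 * s * ω * L)) * Real.exp (-(2 * (s * ω * h))))
            = Real.exp (-(2 * s * ω * L)) * (c * (Real.exp (-(2 * (s * ω * h))) * E (j + 1))) := by
              ring
          _ ≤ _ := by have := hE (j + 1); gcongr
      have a4 := mul_le_mul_of_nonneg_left h2 (Real.exp_pos (-(2 * s * ω * L))).le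
      linarith
  have hpos := Real.exp_pos ((2 * s + 2 * e) * ω * (τ j - τ i))
  have h1 : (τ j - τ i) * F j * Real.exp (-((2 * s + 2 * e) * ω * (τ j - τ i))) ≤ c * E i := by
    have : 0 ≤ c * E j * Real.exp (-(2 * s * ω * (τ j - τ i))) := by
      have := hE j; positivity
    linarith
  rw [Real.exp_neg, ← div_eq_mul_inv, div_le_iff₀ hpos] at h1
  exact h1

/-- The exponent accumulated after `k` steps of the Moser iteration. -/
noncomputable def moserExponent (κ a b γ : ℝ) (k : ℕ) : ℝ :=
  κ ^ k * a - (a + b * k) + κ ^ k * γ * (1 - (1 / 2) ^ k)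

/-- The coefficients are chosen so that `-(a + b k)` is the affine solution of `x (k + 1) = κ x k +
α + δ k`. The `γ` term sums the geometric contributions of `ω`. -/
theorem moserExponent_succ {κ : ℝ} (hκ : 1 < κ) (α δ γ : ℝ) (k : ℕ) :
    moserExponent κ ((α + δ / (κ - 1)) / (κ - 1)) (δ / (κ - 1)) γ (k + 1)
      = κ * moserExponent κ ((α + δ / (κ - 1)) / (κ - 1)) (δ / (κ - 1)) γ k
        + (α + δ * k + κ ^ (k + 1) * γ * (1 / 2) ^ (k + 1)) := by
  have : κ - 1 ≠ 0 := by linarith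
  simp only [moserExponent, pow_succ]
  push_cast
  field_simp
  ring

/-- Level `k` is reached at a partition point just after `t (1 - 2^{-k})`; smoothing on the next
block raises the level by one. -/
theorem moser_iteration {N n : ℕ} {τ : ℕ → ℝ} {F : ℕ → ℕ → ℝ} {q c : ℕ → ℝ}
    {κ m ω t ε Q α δ : ℝ} (hκ : 1 < κ) (hm : 0 < m) (hω : 0 ≤ ω) (ht : 0 < t)
    (hε : 0 < ε) (hεt : ε ≤ t * (1 / 2) ^ (n + 1)) (hq : ∀ k, 0 ≤ q k)
    (hqQ : ∀ k, q k ≤ Q * κ ^ k) (hc : ∀ k, 0 ≤ c k)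
    (hcα : ∀ k, c k * (4 * 2 ^ k) ≤ Real.exp (α + δ * k))
    (h0 : τ 0 = 0) (hN : τ N = t) (hτ : ∀ i < N, τ i < τ (i + 1))
    (hmesh : ∀ i < N, τ (i + 1) - τ i < ε) (hF : ∀ k i, 0 ≤ F k i)
    (hstep : ∀ k < n, ∀ i < N, κ * m * q k * ω * (τ (i + 1) - τ i) ≤ 1 / 2)
    (hgrow : ∀ k, ∀ i < N,
      F k (i + 1) ≤ Real.exp (2 * (m * q k) * ω * (τ (i + 1) - τ i)) * F k i)
    (hen : ∀ k < n, ∀ i < N, (τ (i + 1) - τ i) * F (k + 1) (i + 1)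
      + c k * ((1 - κ * m * q k * ω * (τ (i + 1) - τ i)) * F k (i + 1) ^ κ) ≤ c k * F k i ^ κ) :
    ∀ k ≤ n, ∃ i ≤ N, t * (1 - (1 / 2) ^ k) ≤ τ i ∧ τ i < t * (1 - (1 / 2) ^ k) + ε ∧
      F k i ≤ Real.exp (moserExponent κ ((α - Real.log t + δ / (κ - 1)) / (κ - 1)) (δ / (κ - 1))
        (8 * m * Q * ω * t) k) * F 0 0 ^ (κ ^ k) := by
  intro k
  induction k with
  | zero =>
    intro _
    exact ⟨0, Nat.zero_le _, by simp [h0], by simp [h0, hε], by simp [moserExponent]⟩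
  | succ k ih =>
    intro hk
    obtain ⟨i, hiN, hi1, hi2, hi3⟩ := ih (by omega)
    have hhalf : (0 : ℝ) < (1 / 2) ^ k := by positivity
    have hhalf1 : ((1 : ℝ) / 2) ^ (k + 1) = (1 / 2) ^ k / 2 := by rw [pow_succ]; ring
    have hεk : ε ≤ t * (1 / 2) ^ k / 4 := by
      refine hεt.trans ?_
      have : ((1 : ℝ) / 2) ^ (n + 1) ≤ (1 / 2) ^ (k + 2) :=
        pow_le_pow_of_le_one (by norm_num) (by norm_num) (by omega)
      calc t * (1 / 2) ^ (n + 1) ≤ t * (1 / 2) ^ (k + 2) := by gcongr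
        _ = _ := by rw [pow_add]; ring
    obtain ⟨j, hjN, hj1, hj2⟩ := exists_partition_point (S := t * (1 - (1 / 2) ^ (k + 1))) h0 hε
      hmesh (by
        have : ((1 : ℝ) / 2) ^ (k + 1) ≤ 1 := pow_le_one₀ (by norm_num) (by norm_num)
        exact mul_nonneg ht.le (by linarith)) (by
        rw [hN]
        have : (0 : ℝ) < (1 / 2) ^ (k + 1) := by positivity
        nlinarith)
    refine ⟨j, hjN, hj1, hj2, ?_⟩
    rw [hhalf1] at hj1 hj2
    have htk : 0 < t * (1 / 2) ^ k := by positivity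
    -- The nominal length is `t 2^{-k} / 2`, and the overshoot of `τ i` costs at most half of it.
    have hlen1 : t * (1 / 2) ^ k / 4 ≤ τ j - τ i := by linarith
    have hlen2 : τ j - τ i ≤ t * (1 / 2) ^ k := by linarith
    have hij : i ≤ j := by
      by_contra! hcon
      have := partition_mono hτ hcon.le hiN
      linarith
    have hblock := discrete_smoothing (E := fun i => F k i ^ κ) (F := F (k + 1)) hω (hc k)
      (s := κ * m * q k) (e := m * q (k + 1)) (by have := hq k; positivity)
      (by have := hq (k + 1); positivity) hτ (fun i => Real.rpow_nonneg (hF k i) _) (hF (k + 1))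
      (hstep k (by omega)) (hgrow (k + 1)) (hen k (by omega)) hij hjN
    have hFj := hF (k + 1) j
    have hFi : 0 ≤ F k i ^ κ := Real.rpow_nonneg (hF k i) _
    have hck := hc k
    -- Exponents grow like `κ ^ k` but block lengths shrink like `2^{-k}`; relative to `κ ^ (k + 1)`
    -- the cost of `ω` is therefore summable.
    have hexp : (2 * (κ * m * q k) + 2 * (m * q (k + 1))) * ω * (τ j - τ i)
        ≤ κ ^ (k + 1) * (8 * m * Q * ω * t) * (1 / 2) ^ (k + 1) := by
      have e1 : 2 * (κ * m * q k) + 2 * (m * q (k + 1)) ≤ 4 * m * Q * κ ^ (k + 1) := by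
        have b1 := mul_le_mul_of_nonneg_left (hqQ k) (by positivity : 0 ≤ κ * m)
        have b2 := mul_le_mul_of_nonneg_left (hqQ (k + 1)) hm.le
        rw [pow_succ] at b2 ⊢
        linarith
      have e2 : 0 ≤ τ j - τ i := by linarith
      calc _ ≤ (4 * m * Q * κ ^ (k + 1)) * ω * (τ j - τ i) := by gcongr
        _ ≤ (4 * m * Q * κ ^ (k + 1)) * ω * (t * (1 / 2) ^ k) := by
          refine mul_le_mul_of_nonneg_left hlen2 (mul_nonneg (le_trans ?_ e1) hω)
          have := hq k
          have := hq (k + 1)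
          positivity
        _ = _ := by rw [hhalf1]; ring
    have h1 : t * (1 / 2) ^ k / 4 * F (k + 1) j
        ≤ c k * F k i ^ κ * Real.exp (κ ^ (k + 1) * (8 * m * Q * ω * t) * (1 / 2) ^ (k + 1)) :=
      calc _ ≤ (τ j - τ i) * F (k + 1) j := by gcongr
        _ ≤ _ := hblock
        _ ≤ _ := by gcongr
    have h2 : F (k + 1) j ≤ Real.exp (α - Real.log t + δ * k
        + κ ^ (k + 1) * (8 * m * Q * ω * t) * (1 / 2) ^ (k + 1)) * F k i ^ κ := by
      have e1 : F (k + 1) j = (4 * 2 ^ k) / t * (t * (1 / 2) ^ k / 4 * F (k + 1) j) := by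
        rw [one_div, inv_pow]
        field_simp
      rw [e1]
      calc _ ≤ (4 * 2 ^ k) / t * (c k * F k i ^ κ
            * Real.exp (κ ^ (k + 1) * (8 * m * Q * ω * t) * (1 / 2) ^ (k + 1))) := by gcongr
        _ = (c k * (4 * 2 ^ k)) * t⁻¹ * F k i ^ κ
            * Real.exp (κ ^ (k + 1) * (8 * m * Q * ω * t) * (1 / 2) ^ (k + 1)) := by ring
        _ ≤ Real.exp (α + δ * k) * t⁻¹ * F k i ^ κ
            * Real.exp (κ ^ (k + 1) * (8 * m * Q * ω * t) * (1 / 2) ^ (k + 1)) := by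
          have := hcα k
          gcongr
        _ = _ := by
          rw [← Real.exp_log (inv_pos.2 ht), Real.log_inv, ← Real.exp_add, mul_right_comm,
            ← Real.exp_add]
          congr 2
          ring
    rw [moserExponent_succ hκ]
    refine h2.trans ?_
    have h3 := Real.rpow_le_rpow (hF k i) hi3 (by linarith : 0 ≤ κ)
    rw [Real.mul_rpow (Real.exp_pos _).le (Real.rpow_nonneg (hF 0 0) _), ← Real.exp_mul,
      ← Real.rpow_mul (hF 0 0)] at h3
    refine (mul_le_mul_of_nonneg_left h3 (Real.exp_pos _).le).trans_eq ?_
    rw [← mul_assoc, ← Real.exp_add, ← pow_succ]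
    congr 2
    ring

end Iteration

/-! ### Energy and growth estimates for one implicit step. -/

section Steps

variable {Ω : Type*} [MeasurableSpace Ω] {μ : Measure Ω} {A : Operator (Lp ℝ 1 μ)} {ω : ℝ}
  {u₀ : Lp ℝ 1 μ}

/-- The energy inequality for one step of the implicit time discretization. -/
theorem energy_step {κ m p C q s : ℝ} (hm : 0 < m) (hp : 1 ≤ p) (hpq : p ≤ q) (hC : 0 < C)
    (hs : s = (q - p + 1) * m + 1) (hsob : A.SobolevIneq ω κ m p C u₀ q) (hu₀ : MemLp u₀ ∞ μ)
    {w v f : Lp ℝ 1 μ} (hwv : (w, v) ∈ A.trace) {h : ℝ} (hh : 0 < h) (heq : w + h • v = f) :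
    h * lpNorm (w - u₀ : Lp ℝ 1 μ) (ENNReal.ofReal (κ * m * q)) μ ^ (m * q)
      + (C * (q / p) ^ p / (q - p + 1) / s)
        * ((1 - s * ω * h) * lpNorm (w - u₀ : Lp ℝ 1 μ) (ENNReal.ofReal s) μ ^ s)
      ≤ (C * (q / p) ^ p / (q - p + 1) / s)
        * lpNorm (f - u₀ : Lp ℝ 1 μ) (ENNReal.ofReal s) μ ^ s := by
  have hqp : 0 < q - p + 1 := by linarith
  have hs1 : 1 ≤ s := by rw [hs]; have := mul_pos hqp hm; linarith
  have hs0 : 0 < s := by linarith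
  have hq : 0 ≤ q := by linarith
  have h1 := hsob w v hwv
  rw [← hs] at h1
  have hy : MemLp (w - u₀ : Lp ℝ 1 μ) (ENNReal.ofReal s) μ :=
    memLp_of_memLp_one_top (Lp.memLp _) (memLp_coe_sub hwv.2.1 hu₀) hs1
  have hv : MemLp v (ENNReal.ofReal s) μ := memLp_of_memLp_one_top (Lp.memLp _) hwv.2.2 hs1
  have h2 := mul_qBracket_le hs1 hy hv hh
  have h3 : lpNorm (((w - u₀ : Lp ℝ 1 μ) : Ω → ℝ) + h • (v : Ω → ℝ)) (ENNReal.ofReal s) μ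
      = lpNorm (f - u₀ : Lp ℝ 1 μ) (ENNReal.ofReal s) μ := by
    have e : f - u₀ = (w - u₀) + h • v := by rw [← heq]; abel
    rw [e]
    refine (lpNorm_congr_of_ae (Lp.aestronglyMeasurable _) ?_ _).symm
    exact (Lp.coeFn_add _ _).trans (EventuallyEq.rfl.add (Lp.coeFn_smul h v))
  rw [h3] at h2
  set P := C * (q / p) ^ p / (q - p + 1)
  have hP : 0 ≤ P := by positivity
  set a := lpNorm (w - u₀ : Lp ℝ 1 μ) (ENNReal.ofReal s) μ ^ s
  set b := lpNorm (f - u₀ : Lp ℝ 1 μ) (ENNReal.ofReal s) μ ^ s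
  have h4 := mul_le_mul_of_nonneg_left h1 hh.le
  have h5 := mul_le_mul_of_nonneg_left h2 hP
  have h6 : P / s * b - P / s * ((1 - s * ω * h) * a)
      = P * (1 / s * (b - a)) + P * (ω * h * a) := by
    field_simp; ring
  have h7 : h * (P * (qBracket μ s (w - u₀ : Lp ℝ 1 μ) v + ω * a))
      = P * (h * qBracket μ s (w - u₀ : Lp ℝ 1 μ) v) + P * (ω * h * a) := by ring
  linarith

/-- The exponential form makes the product over many steps depend only on the elapsed time. -/
theorem growth_step {r h : ℝ} (hgrow : A.ResolventGrowth ω u₀ r) (hω : 0 ≤ ω) (hh : 0 < h)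
    (hhω : h * ω ≤ 1 / 2) {w v f : Lp ℝ 1 μ} (hwv : (w, v) ∈ A.trace) (heq : w + h • v = f) :
    lpNorm (w - u₀ : Lp ℝ 1 μ) (ENNReal.ofReal r) μ ≤
      Real.exp (2 * ω * h) * lpNorm (f - u₀ : Lp ℝ 1 μ) (ENNReal.ofReal r) μ := by
  refine (hgrow h hh (by linarith) f ⟨w, v, hwv, heq⟩ w ⟨v, hwv.1, heq⟩).trans ?_
  refine mul_le_mul_of_nonneg_right ?_ lpNorm_nonneg
  have h1 := exp_neg_two_mul_le (x := h * ω) (by positivity) hhω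
  have e : 2 * (h * ω) = 2 * ω * h := by ring
  rw [Real.exp_neg, e] at h1
  exact (inv_le_comm₀ (by linarith) (Real.exp_pos _)).2 h1

end Steps

/-! ### The exponents and constants of the iteration. -/

section Exponents

/-- The exponents `q_k` of the Moser iteration, determined by `q_0 = q₀` and
`q_{k+1} = κ q_k + p - 1 - 1 / m`. -/
noncomputable def moserIndex (κ m p q₀ : ℝ) (k : ℕ) : ℝ :=
  κ ^ k * (((κ - 1) * q₀ + p - 1 - 1 / m) / (κ - 1)) - (p - 1 - 1 / m) / (κ - 1)

/-- A constant `Q` such that `q_k ≤ Q κ ^ k`. -/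
noncomputable def moserIndexBound (κ m p q₀ : ℝ) : ℝ :=
  ((κ - 1) * q₀ + p - 1 - 1 / m) / (κ - 1) + |p - 1 - 1 / m| / (κ - 1)

variable {κ m p q₀ : ℝ}

theorem moserIndex_zero (hκ : 1 < κ) : moserIndex κ m p q₀ 0 = q₀ := by
  have : κ - 1 ≠ 0 := by linarith
  simp only [moserIndex, pow_zero, one_mul]
  rw [← sub_div, div_eq_iff this]
  ring

theorem moserIndex_succ (hκ : 1 < κ) (k : ℕ) :
    moserIndex κ m p q₀ (k + 1) = κ * moserIndex κ m p q₀ k + p - 1 - 1 / m := by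
  have : κ - 1 ≠ 0 := by linarith
  simp only [moserIndex, pow_succ]
  generalize 1 / m = z
  field_simp
  ring

/-- Positivity of `D` makes the coefficient of `κ ^ k` positive, so the sequence stays above its
value at `k = 0`. -/
theorem le_moserIndex (hκ : 1 < κ) (hD : 0 < (κ - 1) * q₀ + p - 1 - 1 / m) (k : ℕ) :
    q₀ ≤ moserIndex κ m p q₀ k := by
  have h1 : (1 : ℝ) ≤ κ ^ k := one_le_pow₀ hκ.le
  have h2 : 0 ≤ ((κ - 1) * q₀ + p - 1 - 1 / m) / (κ - 1) := div_nonneg hD.le (by linarith)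
  have h3 := moserIndex_zero (m := m) (p := p) (q₀ := q₀) hκ
  simp only [moserIndex, pow_zero] at h3 ⊢
  have h4 := mul_le_mul_of_nonneg_right h1 h2
  linarith

theorem moserIndex_le (hκ : 1 < κ) (k : ℕ) :
    moserIndex κ m p q₀ k ≤ moserIndexBound κ m p q₀ * κ ^ k := by
  have h1 : (1 : ℝ) ≤ κ ^ k := one_le_pow₀ hκ.le
  have h0 : 0 < κ - 1 := by linarith
  have h2 : -((p - 1 - 1 / m) / (κ - 1)) ≤ |p - 1 - 1 / m| / (κ - 1) := by
    rw [← neg_div]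
    gcongr
    exact neg_le_abs _
  have h3 : 0 ≤ |p - 1 - 1 / m| / (κ - 1) := by positivity
  have h4 := le_mul_of_one_le_right h3 h1
  simp only [moserIndex, moserIndexBound]
  linarith

theorem moserIndexBound_pos (hκ : 1 < κ) (hD : 0 < (κ - 1) * q₀ + p - 1 - 1 / m) :
    0 < moserIndexBound κ m p q₀ :=
  add_pos_of_pos_of_nonneg (div_pos hD (by linarith)) (div_nonneg (abs_nonneg _) (by linarith))

theorem tendsto_pow_div_moserIndex (hκ : 1 < κ) (hD : 0 < (κ - 1) * q₀ + p - 1 - 1 / m) :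
    Tendsto (fun k => κ ^ k / moserIndex κ m p q₀ k) atTop
      (𝓝 ((κ - 1) / ((κ - 1) * q₀ + p - 1 - 1 / m))) := by
  have h0 : 0 < κ - 1 := by linarith
  have h1 : Tendsto (fun k : ℕ => (κ ^ k)⁻¹) atTop (𝓝 0) :=
    (tendsto_pow_atTop_atTop_of_one_lt hκ).inv_tendsto_atTop
  have h2 : Tendsto (fun k : ℕ => ((κ - 1) * q₀ + p - 1 - 1 / m) / (κ - 1)
      - (κ ^ k)⁻¹ * ((p - 1 - 1 / m) / (κ - 1))) atTop
      (𝓝 (((κ - 1) * q₀ + p - 1 - 1 / m) / (κ - 1) - 0 * ((p - 1 - 1 / m) / (κ - 1)))) :=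
    tendsto_const_nhds.sub (h1.mul_const _)
  rw [zero_mul, sub_zero] at h2
  have h3 := h2.inv₀ (by positivity)
  rw [inv_div] at h3
  refine h3.congr fun k => ?_
  have hk : κ ^ k ≠ 0 := by positivity
  rw [← inv_div (moserIndex κ m p q₀ k)]
  congr 1
  simp only [moserIndex]
  rw [sub_div _ _ (κ ^ k), mul_div_cancel_left₀ _ hk, div_eq_inv_mul (_ / _)]

theorem tendsto_moserIndex (hκ : 1 < κ) (hD : 0 < (κ - 1) * q₀ + p - 1 - 1 / m) :
    Tendsto (moserIndex κ m p q₀) atTop atTop := by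
  refine tendsto_atTop_add_const_right _ _ ?_
  exact (tendsto_pow_atTop_atTop_of_one_lt hκ).atTop_mul_const (div_pos hD (by linarith))

theorem tendsto_moserExponent_div (hκ : 1 < κ) (hD : 0 < (κ - 1) * q₀ + p - 1 - 1 / m)
    (a b γ : ℝ) :
    Tendsto (fun k => moserExponent κ a b γ k / moserIndex κ m p q₀ k) atTop
      (𝓝 ((a + γ) * ((κ - 1) / ((κ - 1) * q₀ + p - 1 - 1 / m)))) := by
  have h1 : Tendsto (fun k : ℕ => (κ ^ k)⁻¹) atTop (𝓝 0) :=
    (tendsto_pow_atTop_atTop_of_one_lt hκ).inv_tendsto_atTop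
  have h2 : Tendsto (fun k : ℕ => (k : ℝ) / κ ^ k) atTop (𝓝 0) := by
    simpa using tendsto_pow_const_div_const_pow_of_one_lt 1 hκ
  have h3 : Tendsto (fun k : ℕ => ((1 : ℝ) / 2) ^ k) atTop (𝓝 0) :=
    tendsto_pow_atTop_nhds_zero_of_lt_one (by norm_num) (by norm_num)
  have h4 : Tendsto (fun k : ℕ => a - (a * (κ ^ k)⁻¹ + b * ((k : ℝ) / κ ^ k))
      + γ * (1 - (1 / 2) ^ k)) atTop (𝓝 (a - (a * 0 + b * 0) + γ * (1 - 0))) :=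
    (tendsto_const_nhds.sub ((h1.const_mul a).add (h2.const_mul b))).add
      ((tendsto_const_nhds.sub h3).const_mul γ)
  have h5 := h4.mul (tendsto_pow_div_moserIndex hκ hD)
  have e : a - (a * 0 + b * 0) + γ * (1 - 0) = a + γ := by ring
  rw [e] at h5
  refine h5.congr fun k => ?_
  have hk : κ ^ k ≠ 0 := by positivity
  rw [mul_div_assoc']
  congr 1
  simp only [moserExponent]
  field_simp

theorem moser_constant_le {C : ℝ} (hκ : 1 < κ) (hm : 0 < m) (hp : 1 ≤ p) (hpq : p ≤ q₀)
    (hκmq : 1 ≤ κ * m * q₀) (hD : 0 < (κ - 1) * q₀ + p - 1 - 1 / m) (hC : 0 < C) (k : ℕ) :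
    C * (moserIndex κ m p q₀ (k + 1) / p) ^ p / (moserIndex κ m p q₀ (k + 1) - p + 1)
        / (κ * m * moserIndex κ m p q₀ k) * (4 * 2 ^ k)
      ≤ Real.exp (Real.log (4 * C * (moserIndexBound κ m p q₀ * κ) ^ p)
        + (Real.log 2 + p * Real.log κ) * k) := by
  have hQ := moserIndexBound_pos hκ hD
  have hκ0 : 0 < κ := by linarith
  have h1 := le_moserIndex hκ hD k
  have h2 := le_moserIndex hκ hD (k + 1)
  have h3 := moserIndex_le (m := m) (p := p) (q₀ := q₀) hκ (k + 1)
  have h4 : 1 ≤ κ * m * moserIndex κ m p q₀ k :=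
    hκmq.trans (mul_le_mul_of_nonneg_left h1 (by positivity))
  set Q := moserIndexBound κ m p q₀
  set q := moserIndex κ m p q₀ (k + 1)
  have hq : 0 ≤ q := by linarith
  -- Both denominators are at least `1`, since `q ≥ q₀ ≥ p` and `κ m q₀ ≥ 1`; what remains is a
  -- power of `q`, hence exponential in `k`.
  have h5 : C * (q / p) ^ p / (q - p + 1) / (κ * m * moserIndex κ m p q₀ k)
      ≤ C * (Q * κ ^ (k + 1)) ^ p := by
    refine (div_le_self (div_nonneg (by positivity) (by linarith)) h4).trans ?_
    refine (div_le_self (by positivity) (by linarith)).trans ?_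
    gcongr
    exact (div_le_self hq hp).trans h3
  have h6 : Real.exp (Real.log (4 * C * (Q * κ) ^ p) + (Real.log 2 + p * Real.log κ) * k)
      = C * (Q * κ ^ (k + 1)) ^ p * (4 * 2 ^ k) := by
    rw [Real.exp_add, Real.exp_log (by positivity), add_mul, Real.exp_add,
      mul_comm (Real.log 2), Real.exp_nat_mul, Real.exp_log (by norm_num),
      mul_assoc p, mul_comm p, mul_comm (Real.log κ), Real.exp_mul, Real.exp_nat_mul,
      Real.exp_log hκ0, pow_succ', ← mul_assoc Q,
      Real.mul_rpow (x := Q * κ) (y := κ ^ k) (by positivity) (by positivity)]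
    ring
  rw [h6]
  gcongr

end Exponents

/-! ### The bound for discrete solutions and its limit. -/

section Smoothing

/-- The bound on the norm in `L^{κ m q_n}` obtained after `n` steps of the Moser iteration from
the norm `a` in `L^{κ m q₀}` of the initial value. -/
noncomputable def moserBound (κ m p q₀ C ω t a : ℝ) (n : ℕ) : ℝ :=
  Real.exp (2 * ω * t) * (Real.exp (moserExponent κ
    ((Real.log (4 * C * (moserIndexBound κ m p q₀ * κ) ^ p) - Real.log t
      + (Real.log 2 + p * Real.log κ) / (κ - 1)) / (κ - 1))
    ((Real.log 2 + p * Real.log κ) / (κ - 1))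
    (8 * m * moserIndexBound κ m p q₀ * ω * t) n)
    * (a ^ (m * q₀)) ^ (κ ^ n)) ^ (1 / (m * moserIndex κ m p q₀ n))

theorem tendsto_moserBound {κ m p q₀ C ω t a : ℝ} (hκ : 1 < κ) (hm : 0 < m) (hq₀ : 0 < q₀)
    (hD : 0 < (κ - 1) * q₀ + p - 1 - 1 / m) (ht : 0 < t) (ha : 0 ≤ a) :
    Tendsto (moserBound κ m p q₀ C ω t a) atTop
      (𝓝 (Real.exp ((Real.log (4 * C * (moserIndexBound κ m p q₀ * κ) ^ p)
            + (Real.log 2 + p * Real.log κ) / (κ - 1))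
            / (m * ((κ - 1) * q₀ + p - 1 - 1 / m)))
        * Real.exp (ω * (2 + 8 * moserIndexBound κ m p q₀ * (κ - 1)
            / ((κ - 1) * q₀ + p - 1 - 1 / m)) * t)
        * t ^ (-(1 / (m * ((κ - 1) * q₀ + p - 1 - 1 / m))))
        * a ^ ((κ - 1) * q₀ / ((κ - 1) * q₀ + p - 1 - 1 / m)))) := by
  have h0 : 0 < κ - 1 := by linarith
  unfold moserBound
  set Q := moserIndexBound κ m p q₀
  set α := Real.log (4 * C * (Q * κ) ^ p)
  set b := (Real.log 2 + p * Real.log κ) / (κ - 1)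
  have h1 := ((tendsto_moserExponent_div hκ hD ((α - Real.log t + b) / (κ - 1)) b
    (8 * m * Q * ω * t)).div_const m).rexp
  have h2 : Tendsto (fun n => a ^ (q₀ * (κ ^ n / moserIndex κ m p q₀ n))) atTop
      (𝓝 (a ^ (q₀ * ((κ - 1) / ((κ - 1) * q₀ + p - 1 - 1 / m))))) :=
    -- The limiting exponent is positive, so the case `a = 0` is covered.
    tendsto_const_nhds.rpow ((tendsto_pow_div_moserIndex hκ hD).const_mul q₀)
      (Or.inr (by positivity))
  have h3 := (h1.mul h2).const_mul (Real.exp (2 * ω * t))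
  have hev := (tendsto_moserIndex hκ hD).eventually_gt_atTop 0
  generalize (κ - 1) * q₀ + p - 1 - 1 / m = D at hD h3 ⊢
  have hlim : Real.exp (2 * ω * t) * (Real.exp (((α - Real.log t + b) / (κ - 1)
        + 8 * m * Q * ω * t) * ((κ - 1) / D) / m) * a ^ (q₀ * ((κ - 1) / D)))
      = Real.exp ((α + b) / (m * D)) * Real.exp (ω * (2 + 8 * Q * (κ - 1) / D) * t)
        * t ^ (-(1 / (m * D))) * a ^ ((κ - 1) * q₀ / D) := by
    rw [Real.rpow_def_of_pos ht, ← mul_assoc, ← Real.exp_add, ← Real.exp_add, ← Real.exp_add]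
    congr 2
    · field_simp
      ring
    · ring
  rw [hlim] at h3
  refine h3.congr' ?_
  filter_upwards [hev] with n hn
  rw [Real.mul_rpow (Real.exp_pos _).le (by positivity), ← Real.exp_mul, ← Real.rpow_mul ha,
    ← Real.rpow_mul ha]
  congr 3
  · field_simp
  · field_simp

variable {Ω : Type*} [MeasurableSpace Ω] {μ : Measure Ω} {A : Operator (Lp ℝ 1 μ)} {ω : ℝ}
  {u₀ : Lp ℝ 1 μ}

/-- Solutions of the discretization with bounded initial value stay in the trace. -/
theorem discretization_mem_trace {r₀ : ℝ} (hgrow : ∀ r, r₀ ≤ r → A.ResolventGrowth ω u₀ r)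
    (hω : 0 ≤ ω) (hA : (A.addSmul ω).IsAccretive) (hu₀ : MemLp u₀ ∞ μ)
    (H : A.TraceRangeCondition ω) {u : Lp ℝ 1 μ} (hu : MemLp u ∞ μ) {U : ℝ → Lp ℝ 1 μ}
    {S ε : ℝ} {N : ℕ} {τ : ℕ → ℝ} {x : ℕ → Lp ℝ 1 μ}
    (hx : A.IsDiscretization u U S ε N τ x) (hε : ε * (1 + ω) ≤ 1 / 2) :
    (∀ i < N, ∃ v, (x (i + 1), v) ∈ A.trace ∧ x (i + 1) + (τ (i + 1) - τ i) • v = x i) ∧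
      ∀ i ≤ N, MemLp (x i) ∞ μ := by
  have step : ∀ i < N, MemLp (x i) ∞ μ →
      ∃ v, (x (i + 1), v) ∈ A.trace ∧ x (i + 1) + (τ (i + 1) - τ i) • v = x i := by
    intro i hi hxi
    obtain ⟨v, hv, heq⟩ := hx.scheme i hi
    have h1 := hx.mesh i hi
    refine ⟨v, mem_trace_of_resolvent hgrow hω hA hu₀ H (sub_pos.2 (hx.step_pos i hi)) ?_ hxi hv
      heq, heq⟩
    refine le_trans ?_ hε
    gcongr
  have mem : ∀ i ≤ N, MemLp (x i) ∞ μ := by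
    intro i
    induction i with
    | zero => intro _; rw [hx.init]; exact hu
    | succ i ih =>
      intro hi
      obtain ⟨v, hv, -⟩ := step i (by omega) (ih (by omega))
      exact hv.2.1
  exact ⟨fun i hi => step i hi (mem i hi.le), mem⟩

theorem lpNorm_discretization_le {κ m p q₀ C : ℝ} (hκ : 1 < κ) (hm : 0 < m) (hp : 1 ≤ p)
    (hpq : p ≤ q₀) (hκmq : 1 ≤ κ * m * q₀) (hD : 0 < (κ - 1) * q₀ + p - 1 - 1 / m) (hC : 0 < C)
    (hω : 0 ≤ ω) (hu₀ : MemLp u₀ ∞ μ)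
    (hyp : ∀ q : ℝ, q₀ ≤ q →
      A.SobolevIneq ω κ m p C u₀ q ∧ A.ResolventGrowth ω u₀ (κ * m * q))
    {u : Lp ℝ 1 μ} {U : ℝ → Lp ℝ 1 μ} {t ε : ℝ} (ht : 0 < t) (hε0 : 0 < ε) {N n : ℕ}
    {τ : ℕ → ℝ} {x : ℕ → Lp ℝ 1 μ} (hx : A.IsDiscretization u U t ε N τ x)
    (htr : ∀ i < N, ∃ v, (x (i + 1), v) ∈ A.trace ∧ x (i + 1) + (τ (i + 1) - τ i) • v = x i)
    (hε : ε * (1 + ω) ≤ 1 / 2) (hεt : ε ≤ t * (1 / 2) ^ (n + 1))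
    (hεn : κ * m * (moserIndexBound κ m p q₀ * κ ^ n) * ω * ε ≤ 1 / 2) :
    lpNorm (x N - u₀ : Lp ℝ 1 μ) (ENNReal.ofReal (κ * m * moserIndex κ m p q₀ n)) μ ≤
      moserBound κ m p q₀ C ω t
        (lpNorm (u - u₀ : Lp ℝ 1 μ) (ENNReal.ofReal (κ * m * q₀)) μ) n := by
  have hκ0 : 0 < κ := by linarith
  have hq₀ : 0 < q₀ := by linarith
  have hQ := moserIndexBound_pos hκ hD
  have hqge := fun k => le_moserIndex hκ hD k
  have hqle := fun k => moserIndex_le (m := m) (p := p) (q₀ := q₀) hκ k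
  have hqz := moserIndex_zero (m := m) (p := p) (q₀ := q₀) hκ
  have hqs := fun k => moserIndex_succ (m := m) (p := p) (q₀ := q₀) hκ k
  have hcα := fun k => moser_constant_le hκ hm hp hpq hκmq hD hC k
  unfold moserBound
  set Q := moserIndexBound κ m p q₀
  set q := moserIndex κ m p q₀
  set a : ℕ → ℕ → ℝ := fun k i =>
    lpNorm (x i - u₀ : Lp ℝ 1 μ) (ENNReal.ofReal (κ * m * q k)) μ with ha
  have ha0 : ∀ k i, 0 ≤ a k i := fun k i => lpNorm_nonneg
  have hqpos : ∀ k, 0 < q k := fun k => hq₀.trans_le (hqge k)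
  have hpos : ∀ i < N, 0 < τ (i + 1) - τ i := fun i hi => sub_pos.2 (hx.step_pos i hi)
  have hgr : ∀ k, ∀ i < N, a k (i + 1) ≤ Real.exp (2 * ω * (τ (i + 1) - τ i)) * a k i := by
    intro k i hi
    obtain ⟨v, hv, heq⟩ := htr i hi
    have hmesh := hx.mesh i hi
    refine growth_step (hyp _ (hqge k)).2 hω (hpos i hi) ?_ hv heq
    have h1 : (τ (i + 1) - τ i) * ω ≤ ε * ω := by gcongr
    linarith
  obtain ⟨i, hiN, hi1, -, hi3⟩ := moser_iteration (n := n) (F := fun k i => a k i ^ (m * q k))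
    (q := q) (ω := ω) (m := m) hκ hm hω ht hε0 hεt (fun k => (hqpos k).le) hqle
    (c := fun k => C * (q (k + 1) / p) ^ p / (q (k + 1) - p + 1) / (κ * m * q k))
    (fun k => by
      have h1 := hqpos k
      have h2 := hqpos (k + 1)
      have h3 : 0 ≤ q (k + 1) - p + 1 := by have := hqge (k + 1); linarith
      positivity) hcα hx.left hx.right hx.step_pos hx.mesh
    (fun k i => Real.rpow_nonneg (ha0 k i) _)
    (fun k hk i hi => by
      refine le_trans ?_ hεn
      have h1 := hqpos k
      have h2 := hx.mesh i hi
      have h3 : q k ≤ Q * κ ^ n := (hqle k).trans (by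
        have := pow_le_pow_right₀ hκ.le hk.le
        gcongr)
      have h4 := hpos i hi
      gcongr)
    (fun k i hi => by
      have h1 := hqpos k
      refine (Real.rpow_le_rpow (ha0 _ _) (hgr k i hi) (by positivity)).trans_eq ?_
      rw [Real.mul_rpow (Real.exp_pos _).le (ha0 _ _), ← Real.exp_mul]
      congr 2
      ring)
    (fun k hk i hi => by
      obtain ⟨v, hv, heq⟩ := htr i hi
      -- The recursion for `q` is exactly what makes `(q (k + 1) - p + 1) m + 1` equal to `κ m q k`.
      have h1 := energy_step (s := κ * m * q k) hm hp (hpq.trans (hqge (k + 1))) hC (by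
        rw [hqs k]; field_simp; ring) (hyp _ (hqge (k + 1))).1 hu₀ hv (hpos i hi) heq
      have e : ∀ j, (a k j ^ (m * q k)) ^ κ = a k j ^ (κ * m * q k) := fun j => by
        rw [← Real.rpow_mul (ha0 k j)]; congr 1; ring
      simp only [e]
      exact h1) n le_rfl
  have hqn := hqpos n
  -- The iteration stops near `t (1 - 2^{-n})`; growth carries the bound to time `t` at the price of
  -- `exp (2 ω t)`.
  have h1 := discrete_growth (F := a n) (g := 2 * ω) (hgr n) hiN le_rfl
  have h2 : τ N - τ i ≤ t := by
    have : 0 ≤ τ i := by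
      refine le_trans (mul_nonneg ht.le ?_) hi1
      have : ((1 : ℝ) / 2) ^ n ≤ 1 := pow_le_one₀ (by norm_num) (by norm_num)
      linarith
    rw [hx.right]; linarith
  have h3 := Real.rpow_le_rpow (Real.rpow_nonneg (ha0 n i) _) hi3
    (by positivity : 0 ≤ 1 / (m * q n))
  rw [← Real.rpow_mul (ha0 n i), mul_one_div_cancel (by positivity), Real.rpow_one] at h3
  have e0 : a 0 0 = lpNorm (u - u₀ : Lp ℝ 1 μ) (ENNReal.ofReal (κ * m * q₀)) μ := by
    simp only [ha, hqz, hx.init]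
  rw [e0, hqz] at h3
  refine h1.trans (mul_le_mul (Real.exp_le_exp.2 ?_) h3 (ha0 n i) (Real.exp_pos _).le)
  gcongr

end Smoothing

end NonlinearSemigroup

/-! ### Passage to the mild solution. -/

theorem mainTheorem8
    (κ m p q₀ C : ℝ) (hκ : 1 < κ) (hm : 0 < m) (hp : 1 ≤ p) (hpq : p ≤ q₀)
    (hκmq : 1 ≤ κ * m * q₀) (hpos : 0 < (κ - 1) * q₀ + p - 1 - 1 / m) (hC : 0 < C) :
    ∃ β : ℝ, 0 ≤ β ∧ ∃ K : ℝ, 0 < K ∧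
      ∀ (Ω : Type*) [MeasurableSpace Ω] (μ : Measure Ω) [SigmaFinite μ]
        (ω : ℝ) (A : NonlinearSemigroup.Operator (Lp ℝ 1 μ)) (u₀ : Lp ℝ 1 μ)
        (T : ℝ → Lp ℝ 1 μ → Lp ℝ 1 μ),
        0 ≤ ω →
        (A.addSmul ω).IsMAccretive →
        A.TraceRangeCondition ω →
        (u₀, 0) ∈ A.trace →
        (∀ q : ℝ, q₀ ≤ q →
          A.SobolevIneq ω κ m p C u₀ q ∧ A.ResolventGrowth ω u₀ (κ * m * q)) →
        A.Generates T →
        ∀ t : ℝ, 0 < t → ∀ u : Lp ℝ 1 μ, u ∈ closure A.dom → MemLp u ∞ μ →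
          MemLp (T t u - u₀ : Lp ℝ 1 μ) ∞ μ ∧
          lpNorm (T t u - u₀ : Lp ℝ 1 μ) ∞ μ ≤
            K * Real.exp (ω * β * t)
              * t ^ (-(1 / (m * ((κ - 1) * q₀ + p - 1 - 1 / m))))
              * lpNorm (u - u₀ : Lp ℝ 1 μ) (ENNReal.ofReal (κ * m * q₀)) μ
                  ^ ((κ - 1) * q₀ / ((κ - 1) * q₀ + p - 1 - 1 / m)) := by
  open NonlinearSemigroup in
  have hQ := moserIndexBound_pos hκ hpos
  have hκ0 : 0 < κ := by linarith
  have hκ1 : 0 < κ - 1 := by linarith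
  have hq₀ : 0 < q₀ := by linarith
  refine ⟨2 + 8 * moserIndexBound κ m p q₀ * (κ - 1) / ((κ - 1) * q₀ + p - 1 - 1 / m),
    by positivity, Real.exp ((Real.log (4 * C * (moserIndexBound κ m p q₀ * κ) ^ p)
            + (Real.log 2 + p * Real.log κ) / (κ - 1))
            / (m * ((κ - 1) * q₀ + p - 1 - 1 / m))), Real.exp_pos _, ?_⟩
  intro Ω _ μ _ ω A u₀ T hω hA hR hu₀ hyp hT t ht u hu hutop
  have hgrow : ∀ r, κ * m * q₀ ≤ r → A.ResolventGrowth ω u₀ r := by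
    intro r hr
    have hκm : 0 < κ * m := by positivity
    have := (hyp (r / (κ * m)) (by rw [le_div_iff₀ hκm]; linarith)).2
    rwa [mul_div_cancel₀ _ hκm.ne'] at this
  have hsol := hT u hu
  set a := lpNorm (u - u₀ : Lp ℝ 1 μ) (ENNReal.ofReal (κ * m * q₀)) μ with ha
  have ha0 : 0 ≤ a := lpNorm_nonneg
  have hbound : ∀ n, eLpNorm (T t u - u₀ : Lp ℝ 1 μ)
      (ENNReal.ofReal (κ * m * moserIndex κ m p q₀ n)) μ
      ≤ ENNReal.ofReal (moserBound κ m p q₀ C ω t a n) := by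
    intro n
    have hr : 1 ≤ κ * m * moserIndex κ m p q₀ n :=
      hκmq.trans (mul_le_mul_of_nonneg_left (le_moserIndex hκ hpos n) (by positivity))
    have hlim : Tendsto (fun j : ℕ => (1 : ℝ) / (j + 1)) atTop (𝓝 0) :=
      tendsto_one_div_add_atTop_nhds_zero_nat
    choose N τ x hx using fun j : ℕ => hsol.approx t ht (1 / ((j : ℝ) + 1)) (by positivity)
    -- The last interval is closed at its right end `t`, so the step function takes the value `x j
    -- (N j)` there.
    have hconv : Tendsto (fun j => x j (N j)) atTop (𝓝 (T t u)) := by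
      rw [tendsto_iff_norm_sub_tendsto_zero]
      refine squeeze_zero (fun _ => norm_nonneg _) (fun j => ?_) hlim
      have hN : N j ≠ 0 := by
        intro h0
        have h1 := (hx j).left
        have h2 := (hx j).right
        rw [h0, h1] at h2
        exact ht.ne h2
      obtain ⟨k, hk⟩ := Nat.exists_eq_succ_of_ne_zero hN
      have hkN : k + 1 = N j := hk.symm
      have h3 := (hx j).close k (by omega) t
      rw [hkN, (hx j).right] at h3
      rw [norm_sub_rev]
      refine h3 ⟨?_, le_rfl⟩
      have := (hx j).step_pos k (by omega)
      rwa [hkN, (hx j).right] at this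
    refine eLpNorm_le_of_tendsto_L1 (hconv.sub_const u₀) ?_
    -- The mesh conditions depend on `n`, which is fixed while the mesh tends to zero.
    have small : ∀ c b : ℝ, 0 < b → ∀ᶠ j : ℕ in atTop, c * (1 / ((j : ℝ) + 1)) ≤ b := by
      intro c b hb
      have := hlim.const_mul c
      rw [mul_zero] at this
      exact (this.eventually (gt_mem_nhds hb)).mono fun _ => le_of_lt
    filter_upwards [small (1 + ω) (1 / 2) (by norm_num),
      small 1 (t * (1 / 2) ^ (n + 1)) (by positivity),
      small (κ * m * (moserIndexBound κ m p q₀ * κ ^ n) * ω) (1 / 2) (by norm_num)] with j h1 h2 h3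
    rw [mul_comm] at h1
    rw [one_mul] at h2
    obtain ⟨htr, hmem⟩ := discretization_mem_trace hgrow hω hA.1 hu₀.2.1 hR hutop (hx j) h1
    rw [← ofReal_lpNorm (memLp_of_memLp_one_top (Lp.memLp _)
      (memLp_coe_sub (hmem _ le_rfl) hu₀.2.1) hr)]
    exact ENNReal.ofReal_le_ofReal (lpNorm_discretization_le hκ hm hp hpq hκmq hpos hC hω
      hu₀.2.1 hyp ht (by positivity) (hx j) htr h1 h2 h3)
  have hfinal := eLpNorm_top_le_of_tendsto (Lp.aestronglyMeasurable _)
    ((tendsto_moserIndex hκ hpos).const_mul_atTop (by positivity : 0 < κ * m))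
    (tendsto_moserBound hκ hm hq₀ hpos ht ha0) (by positivity) hbound
  refine ⟨⟨Lp.aestronglyMeasurable _, hfinal.trans_lt ENNReal.ofReal_lt_top⟩, ?_⟩
  rw [← toReal_eLpNorm (Lp.aestronglyMeasurable _)]
  exact ENNReal.toReal_le_of_le_ofReal (by positivity) hfinal
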